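/- Let $N=\{1,\dots,n\}$ be a set of agents, $L=\{1,\dots,l\}$ a set of commodities, $\Omega\in\mathbb R_+^l$ a fixed social endowment, $X=\prod_{\ell\in L}[0,\Omega^\ell]$ and $Z=\{x\in X^n:\sum_{i\in N}x_i=\Omega\}$. Let $\mathcal R$ be the set of all complete, transitive, continuous and strictly convex preference relations $R_i$ on $X$ (with strict part $P_i$) that are multidimensional single-peaked: there is a peak $p(R_i)\in X$ such that $x_i\,P_i\,\tilde x_i$ whenever $x_i\neq\tilde x_i$ and, for every $\ell$, $x_i^\ell$ lies weakly between $p^\ell(R_i)$ and $\tilde x_i^\ell$. A rule is a function $\varphi:\mathcal R^n\to Z$. It is strategy-proof if $\varphi_i(R)\,R_i\,\varphi_i(R_i',R_{-i})$ for all $R\in\mathcal R^n$, $i\in N$, $R_i'\in\mathcal R$, and own-peak-only if $\varphi_i(R)=\varphi_i(R_i',R_{-i})$ whenever $p(R_i')=p(R_i)$. Let $\Phi^\star$ be the class of strategy-proof and own-peak-only rules. A rule $\psi$ dominates $\varphi$ if $\psi_i(R)\,R_i\,\varphi_i(R)$ for all $R$ and $i$. A rule $\varphi\in\Phi^\star$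 is strongly Pareto-undominated strategy-proof if every $\psi\in\Phi^\star$ that dominates $\varphi$ equals $\varphi$. One-dimensional sequential rules. For $\omega\ge 0$ let $Z_\omega=\{z\in[0,\omega]^n:\sum_i z_i=\omega\}$. A demand adjustment process from an initial reference point $q\in Z_\omega$ assigns to each peak profile $x\in[0,\omega]^n$ with $\sum_i x_i\ge\omega$ a sequence of reference allocations $q^0(x)=q,\ q^1(x),\ q^2(x),\dots$ in $Z_\omega$ such that, calling $i$ satisfied at $(t,x)$ if $x_i\le q_i^t(x)$: (a) if $i$ is satisfied at $(t,x)$, then $q_i^{t+1}(x)=x_i$; (b) otherwise $q_i^{t+1}(x)\ge q_i^t(x)$; (c) if every agent $j$ satisfied at $(t,y)$ is satisfied at $(t,x)$ and has $x_j\le y_j$, and $q_j^t(x)\ge q_j^t(y)$ for every $j$ not satisfied at $(t,x)$, then $q_j^{t+1}(x)\ge q_j^{t+1}(y)$ for every $j$ not satisfied at $(t,x)$. A supply adjustment process is defined in the same way for the profiles with $\sum_i x_i\le\omega$, with all inequalities between amounts of the commodity reversed. A one-dimensional sequential rule is a function $f:[0,\omega]^n\to Z_\omega$ for which there are a demand and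 a supply adjustment process, each with its own initial reference point, such that $f(x)$ is the reference allocation after $n$ steps of the demand process if $\sum_i x_i\ge\omega$, and of the supply process if $\sum_i x_i\le\omega$. A rule $\phi$ is a multidimensional sequential rule if for each $\ell\in L$ there is a one-dimensional sequential rule $\phi^\ell:[0,\Omega^\ell]^n\to Z_{\Omega^\ell}$ such that $\phi_i(R)=\big(\phi_i^1(p^1(R)),\dots,\phi_i^l(p^l(R))\big)$ for all $R\in\mathcal R^n$ and $i\in N$, where $p^\ell(R)=(p^\ell(R_1),\dots,p^\ell(R_n))$. **Theorem 2.** Every multidimensional sequential rule is strongly Pareto-undominated strategy-proof. -/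

import Mathlib

open Set

/-- The consumption set: the box of bundles `x` with `0 ≤ x ℓ ≤ Ω ℓ` for every commodity `ℓ`. -/
abbrev Bundle {l : ℕ} (Ω : Fin l → ℝ) : Type := Icc (0 : Fin l → ℝ) Ω

/-- `y` is (weakly) between `x` and `z`, coordinate by coordinate. -/
def IsBetween {l : ℕ} {Ω : Fin l → ℝ} (x y z : Bundle Ω) : Prop :=
  ∀ ℓ, (x.1 ℓ ≤ y.1 ℓ ∧ y.1 ℓ ≤ z.1 ℓ) ∨ (z.1 ℓ ≤ y.1 ℓ ∧ y.1 ℓ ≤ x.1 ℓ)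

/-- A multidimensional single-peaked preference on the consumption set: a complete, transitive,
continuous, strictly convex weak preference relation (`rel x y` reads "`x` is at least as
desirable as `y`") that is single-peaked. The strict relation is `¬ rel y x`, which, for a
complete relation, is the same as `rel x y ∧ ¬ rel y x`. -/
structure SPPreference {l : ℕ} (Ω : Fin l → ℝ) where
  rel : Bundle Ω → Bundle Ω → Prop
  complete : ∀ x y, rel x y ∨ rel y x
  transitive : ∀ x y z, rel x y → rel y z → rel x z
  continuous_upper : ∀ x, IsClosed {y | rel y x}
  continuous_lower : ∀ x, IsClosed {y | rel x y}
  strictly_convex : ∀ x y z w : Bundle Ω, x ≠ y → rel x z → rel y z →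
    (w : Fin l → ℝ) ∈ openSegment ℝ (x : Fin l → ℝ) (y : Fin l → ℝ) → ¬ rel z w
  single_peaked : ∃ p : Bundle Ω, ∀ x y : Bundle Ω, x ≠ y → IsBetween p x y → ¬ rel y x

namespace SPPreference

variable {l : ℕ} {Ω : Fin l → ℝ}

/-- The peak of a preference (unique, see `rel_iff_eq_peak`). -/
noncomputable def peak (R : SPPreference Ω) : Bundle Ω := Classical.choose R.single_peaked

theorem peak_spec (R : SPPreference Ω) (x y : Bundle Ω) (hxy : x ≠ y)
    (h : IsBetween R.peak x y) : ¬ R.rel y x :=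
  Classical.choose_spec R.single_peaked x y hxy h

/-- The peak is the one and only most preferred bundle. -/
theorem rel_iff_eq_peak (R : SPPreference Ω) (x : Bundle Ω) :
    (∀ y, R.rel x y) ↔ x = R.peak := by
  have key : ∀ y, R.peak ≠ y → ¬ R.rel y R.peak := fun y hy =>
    R.peak_spec _ _ hy fun ℓ => by
      rcases le_total (R.peak.1 ℓ) (y.1 ℓ) with h | h
      · exact Or.inl ⟨le_rfl, h⟩
      · exact Or.inr ⟨h, le_rfl⟩
  constructor
  · intro h
    by_contra hne
    exact key x (Ne.symm hne) (h _)
  · rintro rfl y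
    rcases R.complete R.peak y with h | h
    · exact h
    · by_cases hy : R.peak = y
      · rw [← hy] at h ⊢
        exact h
      · exact absurd h (key y hy)

end SPPreference

/-- Feasible allocations: every agent gets a bundle, and the bundles add up to the endowment. -/
abbrev Allocation (n : ℕ) {l : ℕ} (Ω : Fin l → ℝ) : Type :=
  {z : Fin n → Bundle Ω // ∑ i, (z i : Fin l → ℝ) = Ω}

/-- Allocation rules on the domain of all multidimensional single-peaked preferences. -/
abbrev Rule (n : ℕ) {l : ℕ} (Ω : Fin l → ℝ) : Type :=
  (Fin n → SPPreference Ω) → Allocation n Ω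

namespace Rule

variable {n l : ℕ} {Ω : Fin l → ℝ}

/-- No agent ever gains by reporting a false preference. -/
def StrategyProof (φ : Rule n Ω) : Prop :=
  ∀ (R : Fin n → SPPreference Ω) (i : Fin n) (R' : SPPreference Ω),
    (R i).rel ((φ R).1 i) ((φ (Function.update R i R')).1 i)

/-- An agent's assignment depends on her own preference only through its peak. -/
def OwnPeakOnly (φ : Rule n Ω) : Prop :=
  ∀ (R : Fin n → SPPreference Ω) (i : Fin n) (R' : SPPreference Ω),
    R'.peak = (R i).peak → (φ R).1 i = (φ (Function.update R i R')).1 i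

/-- `φ` dominates `ψ`: every agent always finds `φ` at least as desirable as `ψ`. -/
def Dominates (φ ψ : Rule n Ω) : Prop :=
  ∀ (R : Fin n → SPPreference Ω) (i : Fin n), (R i).rel ((φ R).1 i) ((ψ R).1 i)

/-- `φ` is strategy-proof and own-peak-only, and no other strategy-proof and own-peak-only rule
dominates it. -/
def StronglyParetoUndominatedStrategyProof (φ : Rule n Ω) : Prop :=
  (StrategyProof φ ∧ OwnPeakOnly φ) ∧
    ∀ ψ : Rule n Ω, StrategyProof ψ → OwnPeakOnly ψ → Dominates ψ φ → φ = ψ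

end Rule

/-- Feasible allocations of an amount `ω` of a single commodity. -/
abbrev Allocation₁ (n : ℕ) (ω : ℝ) : Type :=
  {z : Fin n → Icc (0 : ℝ) ω // ∑ i, (z i : ℝ) = ω}

/-- Sequential adjustment of reference allocations, at peak profiles `x` with excess demand
(`∑ x ≥ ω`). `ref t x` is the reference allocation after `t` steps, starting from `q₀`. An agent is
satisfied at step `t` if her peak is at most her reference amount. -/
structure IsDemandAdjustment {n : ℕ} {ω : ℝ} (q₀ : Allocation₁ n ω)
    (ref : ℕ → (Fin n → Icc (0 : ℝ) ω) → Allocation₁ n ω) : Prop where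
  /-- The process starts from the initial reference point. -/
  start : ∀ x : Fin n → Icc (0 : ℝ) ω, ω ≤ ∑ i, (x i : ℝ) → ref 0 x = q₀
  /-- Satisfied agents are assigned their peaks. -/
  satisfied : ∀ (t : ℕ) (x : Fin n → Icc (0 : ℝ) ω), ω ≤ ∑ i, (x i : ℝ) →
    ∀ i, x i ≤ (ref t x).1 i → (ref (t + 1) x).1 i = x i
  /-- Reference amounts of the other agents do not decrease. -/
  unsatisfied : ∀ (t : ℕ) (x : Fin n → Icc (0 : ℝ) ω), ω ≤ ∑ i, (x i : ℝ) →
    ∀ i, (ref t x).1 i < x i → (ref t x).1 i ≤ (ref (t + 1) x).1 i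
  /-- Monotonicity: if every agent satisfied at `y` is satisfied at `x`, with a peak that is not
  larger, and the reference amounts of the agents unsatisfied at `x` are at least as large as at
  `y`, then the latter remains true one step later. (Applied in both directions: the next
  reference allocation depends on the current one and on the peaks of the satisfied agents only,
  not on the peaks of the unsatisfied ones.) -/
  monotone : ∀ (t : ℕ) (x y : Fin n → Icc (0 : ℝ) ω),
    ω ≤ ∑ i, (x i : ℝ) → ω ≤ ∑ i, (y i : ℝ) →
    (∀ i, y i ≤ (ref t y).1 i → x i ≤ (ref t x).1 i ∧ x i ≤ y i) →
    (∀ i, (ref t x).1 i < x i → (ref t y).1 i ≤ (ref t x).1 i) →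
    ∀ i, (ref t x).1 i < x i → (ref (t + 1) y).1 i ≤ (ref (t + 1) x).1 i

/-- The mirror image of `IsDemandAdjustment`, at peak profiles with excess supply (`∑ x ≤ ω`): an
agent is satisfied if her peak is at least her reference amount, and reference amounts of
unsatisfied agents do not increase. -/
structure IsSupplyAdjustment {n : ℕ} {ω : ℝ} (q₀ : Allocation₁ n ω)
    (ref : ℕ → (Fin n → Icc (0 : ℝ) ω) → Allocation₁ n ω) : Prop where
  start : ∀ x : Fin n → Icc (0 : ℝ) ω, ∑ i, (x i : ℝ) ≤ ω → ref 0 x = q₀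
  satisfied : ∀ (t : ℕ) (x : Fin n → Icc (0 : ℝ) ω), ∑ i, (x i : ℝ) ≤ ω →
    ∀ i, (ref t x).1 i ≤ x i → (ref (t + 1) x).1 i = x i
  unsatisfied : ∀ (t : ℕ) (x : Fin n → Icc (0 : ℝ) ω), ∑ i, (x i : ℝ) ≤ ω →
    ∀ i, x i < (ref t x).1 i → (ref (t + 1) x).1 i ≤ (ref t x).1 i
  monotone : ∀ (t : ℕ) (x y : Fin n → Icc (0 : ℝ) ω),
    ∑ i, (x i : ℝ) ≤ ω → ∑ i, (y i : ℝ) ≤ ω →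
    (∀ i, (ref t y).1 i ≤ y i → (ref t x).1 i ≤ x i ∧ y i ≤ x i) →
    (∀ i, x i < (ref t x).1 i → (ref t x).1 i ≤ (ref t y).1 i) →
    ∀ i, x i < (ref t x).1 i → (ref (t + 1) x).1 i ≤ (ref (t + 1) y).1 i

/-- One-dimensional sequential rules: the outcome, after as many steps as there are agents, of a
sequential adjustment from an initial reference point. The initial reference points for excess
demand and for excess supply may be the same, but need not be. (When the peaks add up to `ω`, both
processes end at the peaks.) -/
def IsSequentialRule₁ {n : ℕ} {ω : ℝ} (f : (Fin n → Icc (0 : ℝ) ω) → Allocation₁ n ω) : Prop :=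
  ∃ (qD qS : Allocation₁ n ω) (refD refS : ℕ → (Fin n → Icc (0 : ℝ) ω) → Allocation₁ n ω),
    IsDemandAdjustment qD refD ∧ IsSupplyAdjustment qS refS ∧
    ∀ x, (ω ≤ ∑ i, (x i : ℝ) → f x = refD n x) ∧ (∑ i, (x i : ℝ) ≤ ω → f x = refS n x)

/-- The projection of the profile of peaks onto commodity `ℓ`. -/
noncomputable def peakProj {n l : ℕ} {Ω : Fin l → ℝ} (R : Fin n → SPPreference Ω) (ℓ : Fin l) :
    Fin n → Icc (0 : ℝ) (Ω ℓ) :=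
  fun i => ⟨(R i).peak.1 ℓ, (R i).peak.2.1 ℓ, (R i).peak.2.2 ℓ⟩

/-- Multidimensional sequential rules: commodity by commodity, a one-dimensional sequential rule is
applied to the projection of the peaks. -/
def IsMultidimSequentialRule {n l : ℕ} {Ω : Fin l → ℝ} (φ : Rule n Ω) : Prop :=
  ∃ f : ∀ ℓ : Fin l, (Fin n → Icc (0 : ℝ) (Ω ℓ)) → Allocation₁ n (Ω ℓ),
    (∀ ℓ, IsSequentialRule₁ (f ℓ)) ∧
    ∀ (R : Fin n → SPPreference Ω) (i : Fin n) (ℓ : Fin l),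
      ((φ R).1 i).1 ℓ = (((f ℓ) (peakProj R ℓ)).1 i : ℝ)

/-! Both halves of the theorem rest on betweenness with respect to the peak. For one commodity, a
sequential rule puts every agent on the same side of her peak: below it under excess demand
(`le_peak`), above it under excess supply (`peak_le`). A rationed agent moreover cannot influence
the process by her peak until she is satisfied, so a false report never moves her amount past the
truthful one towards her peak (`IsSequentialRule₁.between`). Applied to each commodity, this
betweenness and single-peakedness give strategy-proofness. For undominatedness, own-peak-only rules
keep an agent's bundles fixed when her preference varies with the same peak. A dominating rule must
therefore please all preferences with that peak, and those with steep one-sided penalties force its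
bundle to lie between the peak and the dominated bundle (`isBetween_of_forall_rel`). In each
commodity all agents then move weakly in the same direction while the total stays fixed, so nobody
moves. -/

/-! ### Adjustment paths at a fixed profile of peaks. -/

/-- A real-valued demand adjustment path of the amount `ω` at one fixed peak profile `x`. Supply
adjustment paths become such paths after a change of sign. -/
structure IsAdjustmentPath {ι : Type*} [Fintype ι] (ω : ℝ) (x : ι → ℝ) (q : ℕ → ι → ℝ) : Prop where
  sum_eq : ∀ t, ∑ i, q t i = ω
  satisfied : ∀ t i, x i ≤ q t i → q (t + 1) i = x i
  unsatisfied : ∀ t i, q t i < x i → q t i ≤ q (t + 1) i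

namespace IsAdjustmentPath

variable {ι : Type*} [Fintype ι] {ω : ℝ} {x : ι → ℝ} {q : ℕ → ι → ℝ}

theorem satisfied_succ (h : IsAdjustmentPath ω x q) {t : ℕ} {i : ι} (hi : x i ≤ q t i) :
    x i ≤ q (t + 1) i :=
  (h.satisfied t i hi).ge

theorem satisfied_of_le (h : IsAdjustmentPath ω x q) {s t : ℕ} (hst : s ≤ t) {i : ι}
    (hi : x i ≤ q s i) : x i ≤ q t i := by
  induction t, hst using Nat.le_induction with
  | base => exact hi
  | succ t _ ih => exact h.satisfied_succ ih

theorem eq_peak_of_lt (h : IsAdjustmentPath ω x q) {s t : ℕ} (hst : s < t) {i : ι}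
    (hi : x i ≤ q s i) : q t i = x i := by
  obtain ⟨t, rfl⟩ : ∃ u, t = u + 1 := ⟨t - 1, by omega⟩
  exact h.satisfied t i (h.satisfied_of_le (by omega) hi)

/-- Being satisfied is permanent, so an agent unsatisfied at `t` was unsatisfied all along, and her
reference amount never fell. -/
theorem le_of_unsatisfied (h : IsAdjustmentPath ω x q) {s t : ℕ} (hst : s ≤ t) {i : ι}
    (hi : q t i < x i) : q s i ≤ q t i := by
  induction t, hst using Nat.le_induction with
  | base => exact le_rfl
  | succ t _ ih =>
    have ht : q t i < x i := by
      by_contra hc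
      exact absurd (h.satisfied_succ (not_lt.1 hc)) (not_le.2 hi)
    exact (ih ht).trans (h.unsatisfied t i ht)

/-- A reference allocation that exceeds no peak is never revised. -/
theorem succ_eq_of_le (h : IsAdjustmentPath ω x q) {t : ℕ} (ht : ∀ i, q t i ≤ x i) :
    q (t + 1) = q t := by
  have hle : ∀ i ∈ Finset.univ, q t i ≤ q (t + 1) i := fun i _ => by
    rcases (ht i).lt_or_eq with hi | hi
    · exact h.unsatisfied t i hi
    · exact hi.le.trans (h.satisfied_succ hi.ge)
  have := (Finset.sum_eq_sum_iff_of_le hle).1 ((h.sum_eq t).trans (h.sum_eq (t + 1)).symm)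
  exact funext fun i => (this i (Finset.mem_univ i)).symm

theorem le_peak_of_le (h : IsAdjustmentPath ω x q) {s t : ℕ} (hst : s ≤ t)
    (hs : ∀ i, q s i ≤ x i) : ∀ i, q t i ≤ x i := by
  induction t, hst using Nat.le_induction with
  | base => exact hs
  | succ t _ ih => rw [h.succ_eq_of_le ih]; exact ih

/-- If some peak is still exceeded after `t` steps, then every step so far has brought a newly
satisfied agent. -/
theorem lt_card_satisfied (h : IsAdjustmentPath ω x q) (t : ℕ) (ht : ∃ i, x i < q t i) :
    t < (Finset.univ.filter fun i => x i ≤ q t i).card := by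
  induction t with
  | zero =>
    obtain ⟨i, hi⟩ := ht
    exact Finset.card_pos.2 ⟨i, by simp [hi.le]⟩
  | succ t ih =>
    obtain ⟨i, hi⟩ := ht
    have hprev : ∃ j, x j < q t j := by
      by_contra! hc
      exact absurd (h.le_peak_of_le t.le_succ hc i) (not_le.2 hi)
    -- Agent `i` is newly satisfied: had she been satisfied at `t`, she would now receive exactly
    -- her peak.
    refine (Nat.succ_le_of_lt (ih hprev)).trans_lt (Finset.card_lt_card ?_)
    rw [Finset.ssubset_iff_of_subset]
    · refine ⟨i, by simp [hi.le], fun hc => ?_⟩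
      exact hi.ne' (h.satisfied t i (by simpa using hc))
    · intro j hj
      simp only [Finset.mem_filter, Finset.mem_univ, true_and] at hj ⊢
      exact h.satisfied_succ hj

/-- After as many steps as agents, an exceeded peak would require more satisfied agents than there
are agents. -/
theorem le_peak (h : IsAdjustmentPath ω x q) (i : ι) : q (Fintype.card ι) i ≤ x i := by
  by_contra hc
  exact absurd (h.lt_card_satisfied _ ⟨i, not_le.1 hc⟩)
    (not_lt.2 (Finset.card_le_univ _))

/-- If two paths differ in the peak of agent `i` only, and the next reference allocation does not
depend on the peaks of unsatisfied agents, then the final assignment of `i` at `y` cannot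
exceed the one at `x` if `i` is rationed at `x`. -/
theorem le_of_eq_off {y : ι → ℝ} {r : ℕ → ι → ℝ} (hx : IsAdjustmentPath ω x q)
    (hy : IsAdjustmentPath ω y r) (h0 : q 0 = r 0)
    (hstep : ∀ t, q t = r t → (∀ j, x j ≤ q t j → x j = y j) → (∀ j, y j ≤ r t j → x j = y j) →
      ∀ j, q t j < x j → q (t + 1) j = r (t + 1) j)
    {i : ι} (hxy : ∀ j, j ≠ i → x j = y j) {T : ℕ} (hT : q T i < x i) : r T i ≤ q T i := by
  have hun : ∀ t ≤ T, q t i < x i := fun t ht => by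
    by_contra hc
    exact absurd (hx.satisfied_of_le ht (not_lt.1 hc)) (not_le.2 hT)
  have heq : ∀ s ≤ T, (∀ t < s, r t i < y i) → q s = r s := fun s => by
    induction s with
    | zero => exact fun _ _ => h0
    | succ t ih =>
      intro ht hr
      have hqr := ih (by omega) fun u hu => hr u (by omega)
      have hxs : ∀ j, x j ≤ q t j → x j = y j := fun j hj =>
        hxy j (by rintro rfl; exact absurd hj (not_le.2 (hun t (by omega))))
      have hys : ∀ j, y j ≤ r t j → x j = y j := fun j hj =>
        hxy j (by rintro rfl; exact absurd hj (not_le.2 (hr t (by omega))))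
      funext j
      rcases lt_or_ge (q t j) (x j) with hj | hj
      · exact hstep t hqr hxs hys j hj
      · rw [hx.satisfied t j hj, hxs j hj, hy.satisfied t j (by rw [← hxs j hj, ← hqr]; exact hj)]
  -- If `i` becomes satisfied at `y`, let `s` be the first such step: she is fixed at `y i ≤ r s i =
  -- q s i`, and `q` does not decrease for her up to `T`.
  by_cases hsat : ∃ t < T, y i ≤ r t i
  · classical
    obtain ⟨hsT, hs⟩ := Nat.find_spec hsat
    set s := Nat.find hsat
    rw [hy.eq_peak_of_lt hsT hs]
    calc y i ≤ r s i := hs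
      _ = q s i := by
        rw [heq s hsT.le fun t ht => ?_]
        by_contra! hc
        exact Nat.find_min hsat ht ⟨ht.trans hsT, hc⟩
      _ ≤ q T i := hx.le_of_unsatisfied hsT.le hT
  · push Not at hsat
    rw [heq T le_rfl hsat]

end IsAdjustmentPath

/-! ### Sequential rules for one commodity. -/

section OneDimensional

variable {n : ℕ} {ω : ℝ}

theorem IsDemandAdjustment.isAdjustmentPath {q₀ : Allocation₁ n ω}
    {ref : ℕ → (Fin n → Icc (0 : ℝ) ω) → Allocation₁ n ω} (h : IsDemandAdjustment q₀ ref)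
    {x : Fin n → Icc (0 : ℝ) ω} (hx : ω ≤ ∑ i, (x i : ℝ)) :
    IsAdjustmentPath ω (fun i => (x i : ℝ)) (fun t i => ((ref t x).1 i : ℝ)) where
  sum_eq t := (ref t x).2
  satisfied t i hi := congrArg Subtype.val (h.satisfied t x hx i hi)
  unsatisfied t i hi := h.unsatisfied t x hx i hi

theorem IsSupplyAdjustment.isAdjustmentPath {q₀ : Allocation₁ n ω}
    {ref : ℕ → (Fin n → Icc (0 : ℝ) ω) → Allocation₁ n ω} (h : IsSupplyAdjustment q₀ ref)
    {x : Fin n → Icc (0 : ℝ) ω} (hx : ∑ i, (x i : ℝ) ≤ ω) :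
    IsAdjustmentPath (-ω) (fun i => -(x i : ℝ)) (fun t i => -((ref t x).1 i : ℝ)) where
  sum_eq t := by rw [Finset.sum_neg_distrib, (ref t x).2]
  satisfied t i hi :=
    congrArg Neg.neg (congrArg Subtype.val
      (h.satisfied t x hx i (Subtype.coe_le_coe.1 (neg_le_neg_iff.1 hi))))
  unsatisfied t i hi :=
    neg_le_neg (h.unsatisfied t x hx i (Subtype.coe_lt_coe.1 (neg_lt_neg_iff.1 hi)))

theorem IsDemandAdjustment.le_peak {q₀ : Allocation₁ n ω}
    {ref : ℕ → (Fin n → Icc (0 : ℝ) ω) → Allocation₁ n ω} (h : IsDemandAdjustment q₀ ref)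
    {x : Fin n → Icc (0 : ℝ) ω} (hx : ω ≤ ∑ i, (x i : ℝ)) (i : Fin n) :
    (ref n x).1 i ≤ x i := by
  have := (h.isAdjustmentPath hx).le_peak i
  rwa [Fintype.card_fin] at this

theorem IsSupplyAdjustment.peak_le {q₀ : Allocation₁ n ω}
    {ref : ℕ → (Fin n → Icc (0 : ℝ) ω) → Allocation₁ n ω} (h : IsSupplyAdjustment q₀ ref)
    {x : Fin n → Icc (0 : ℝ) ω} (hx : ∑ i, (x i : ℝ) ≤ ω) (i : Fin n) :
    x i ≤ (ref n x).1 i := by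
  have := (h.isAdjustmentPath hx).le_peak i
  rw [Fintype.card_fin] at this
  exact Subtype.coe_le_coe.1 (neg_le_neg_iff.1 this)

/-- When the references and the peaks of satisfied agents agree, `monotone` applies in both
directions and yields equal next references for the unsatisfied agents. -/
theorem IsDemandAdjustment.le_of_eq_off {q₀ : Allocation₁ n ω}
    {ref : ℕ → (Fin n → Icc (0 : ℝ) ω) → Allocation₁ n ω} (h : IsDemandAdjustment q₀ ref)
    {x y : Fin n → Icc (0 : ℝ) ω} (hx : ω ≤ ∑ i, (x i : ℝ)) (hy : ω ≤ ∑ i, (y i : ℝ))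
    {i : Fin n} (hxy : ∀ j, j ≠ i → x j = y j) {T : ℕ} (hT : (ref T x).1 i < x i) :
    (ref T y).1 i ≤ (ref T x).1 i := by
  refine (h.isAdjustmentPath hx).le_of_eq_off (h.isAdjustmentPath hy) ?_ ?_
    (fun j hj => congrArg Subtype.val (hxy j hj)) hT
  · simp only [h.start x hx, h.start y hy]
  · intro t hq hxs hys j hj
    have hq' : ∀ k, (ref t x).1 k = (ref t y).1 k := fun k => Subtype.ext (congrFun hq k)
    have hxs' : ∀ k, x k ≤ (ref t x).1 k → x k = y k := fun k hk => Subtype.ext (hxs k hk)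
    have hys' : ∀ k, y k ≤ (ref t y).1 k → x k = y k := fun k hk => Subtype.ext (hys k hk)
    have hj' : (ref t y).1 j < y j := by
      by_contra hc
      have := hys' j (not_lt.1 hc)
      exact hc (by rw [← this, ← hq']; exact hj)
    refine le_antisymm ?_ ?_
    · refine h.monotone t y x hy hx (fun k hk => ?_) (fun k _ => (hq' k).le) j hj'
      rw [← hq', ← hxs' k hk]
      exact ⟨hk, le_rfl⟩
    · refine h.monotone t x y hx hy (fun k hk => ?_) (fun k _ => (hq' k).ge) j hj
      rw [hq', hys' k hk]
      exact ⟨hk, le_rfl⟩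

theorem IsSupplyAdjustment.le_of_eq_off {q₀ : Allocation₁ n ω}
    {ref : ℕ → (Fin n → Icc (0 : ℝ) ω) → Allocation₁ n ω} (h : IsSupplyAdjustment q₀ ref)
    {x y : Fin n → Icc (0 : ℝ) ω} (hx : ∑ i, (x i : ℝ) ≤ ω) (hy : ∑ i, (y i : ℝ) ≤ ω)
    {i : Fin n} (hxy : ∀ j, j ≠ i → x j = y j) {T : ℕ} (hT : x i < (ref T x).1 i) :
    (ref T x).1 i ≤ (ref T y).1 i := by
  refine Subtype.coe_le_coe.1 (neg_le_neg_iff.1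
    ((h.isAdjustmentPath hx).le_of_eq_off (h.isAdjustmentPath hy) ?_ ?_
    (fun j hj => congrArg (fun z : Icc (0 : ℝ) ω => -(z : ℝ)) (hxy j hj))
    (neg_lt_neg_iff.2 hT)))
  · simp only [h.start x hx, h.start y hy]
  · intro t hq hxs hys j hj
    have hj := neg_lt_neg_iff.1 hj
    have hq' : ∀ k, (ref t x).1 k = (ref t y).1 k := fun k =>
      Subtype.ext (neg_injective (congrFun hq k))
    have hxs' : ∀ k, (ref t x).1 k ≤ x k → x k = y k := fun k hk =>
      Subtype.ext (neg_injective (hxs k (neg_le_neg hk)))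
    have hys' : ∀ k, (ref t y).1 k ≤ y k → x k = y k := fun k hk =>
      Subtype.ext (neg_injective (hys k (neg_le_neg hk)))
    have hj' : y j < (ref t y).1 j := by
      by_contra hc
      have := hys' j (not_lt.1 hc)
      exact hc (by rw [← this, ← hq']; exact hj)
    refine congrArg Neg.neg (le_antisymm ?_ ?_)
    · refine h.monotone t x y hx hy (fun k hk => ?_) (fun k _ => (hq' k).le) j hj
      rw [hq', hys' k hk]
      exact ⟨hk, le_rfl⟩
    · refine h.monotone t y x hy hx (fun k hk => ?_) (fun k _ => (hq' k).ge) j hj'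
      rw [← hq', ← hxs' k hk]
      exact ⟨hk, le_rfl⟩

variable {f : (Fin n → Icc (0 : ℝ) ω) → Allocation₁ n ω}

theorem IsSequentialRule₁.le_peak (hf : IsSequentialRule₁ f) {x : Fin n → Icc (0 : ℝ) ω}
    (hx : ω ≤ ∑ i, (x i : ℝ)) (i : Fin n) : (f x).1 i ≤ x i := by
  obtain ⟨qD, qS, refD, refS, hD, -, h⟩ := hf
  rw [(h x).1 hx]
  exact hD.le_peak hx i

theorem IsSequentialRule₁.peak_le (hf : IsSequentialRule₁ f) {x : Fin n → Icc (0 : ℝ) ω}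
    (hx : ∑ i, (x i : ℝ) ≤ ω) (i : Fin n) : x i ≤ (f x).1 i := by
  obtain ⟨qD, qS, refD, refS, -, hS, h⟩ := hf
  rw [(h x).2 hx]
  exact hS.peak_le hx i

theorem IsSequentialRule₁.le_of_demand (hf : IsSequentialRule₁ f) {x y : Fin n → Icc (0 : ℝ) ω}
    (hx : ω ≤ ∑ i, (x i : ℝ)) (hy : ω ≤ ∑ i, (y i : ℝ)) {i : Fin n}
    (hxy : ∀ j, j ≠ i → x j = y j) (hi : (f x).1 i < x i) : (f y).1 i ≤ (f x).1 i := by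
  obtain ⟨qD, qS, refD, refS, hD, -, h⟩ := hf
  rw [(h x).1 hx] at hi ⊢
  rw [(h y).1 hy]
  exact hD.le_of_eq_off hx hy hxy hi

theorem IsSequentialRule₁.le_of_supply (hf : IsSequentialRule₁ f) {x y : Fin n → Icc (0 : ℝ) ω}
    (hx : ∑ i, (x i : ℝ) ≤ ω) (hy : ∑ i, (y i : ℝ) ≤ ω) {i : Fin n}
    (hxy : ∀ j, j ≠ i → x j = y j) (hi : x i < (f x).1 i) : (f x).1 i ≤ (f y).1 i := by
  obtain ⟨qD, qS, refD, refS, -, hS, h⟩ := hf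
  rw [(h x).2 hx] at hi ⊢
  rw [(h y).2 hy]
  exact hS.le_of_eq_off hx hy hxy hi

/-- Between a profile with excess supply and one with excess demand that differ in the peak of one
agent only, there is a balanced one. -/
theorem exists_balanced {x y : Fin n → Icc (0 : ℝ) ω} (hx : ω ≤ ∑ i, (x i : ℝ))
    (hy : ∑ i, (y i : ℝ) ≤ ω) {i : Fin n} (hxy : ∀ j, j ≠ i → x j = y j) :
    ∃ z : Fin n → Icc (0 : ℝ) ω, ∑ j, (z j : ℝ) = ω ∧ ∀ j, j ≠ i → x j = z j := by
  have hsx := Finset.add_sum_erase Finset.univ (fun j => (x j : ℝ)) (Finset.mem_univ i)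
  have hsy := Finset.add_sum_erase Finset.univ (fun j => (y j : ℝ)) (Finset.mem_univ i)
  have hs : ∑ j ∈ Finset.univ.erase i, (x j : ℝ) = ∑ j ∈ Finset.univ.erase i, (y j : ℝ) :=
    Finset.sum_congr rfl fun j hj => by rw [hxy j (Finset.ne_of_mem_erase hj)]
  have h0 := (y i).2.1
  have h1 := (x i).2.2
  -- The balancing peak `c` lies between `y i` and `x i`, hence in `[0, ω]`.
  obtain ⟨c, hc⟩ : ∃ c : Icc (0 : ℝ) ω, (c : ℝ) = ω - ∑ j ∈ Finset.univ.erase i, (x j : ℝ) :=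
    ⟨⟨_, by linarith, by linarith⟩, rfl⟩
  refine ⟨Function.update x i c, ?_, fun j hj => by rw [Function.update_of_ne hj]⟩
  have hsc : ∑ j ∈ Finset.univ.erase i, (Function.update x i c j : ℝ) =
      ∑ j ∈ Finset.univ.erase i, (x j : ℝ) :=
    Finset.sum_congr rfl fun j hj => by rw [Function.update_of_ne (Finset.ne_of_mem_erase hj)]
  rw [← Finset.add_sum_erase Finset.univ _ (Finset.mem_univ i), hsc, Function.update_self, hc]
  ring

/-- Profiles that differ in the peak of one agent only are ordered as their totals are. -/
theorem le_of_sum_le_of_eq_off {x y : Fin n → Icc (0 : ℝ) ω} {i : Fin n}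
    (hxy : ∀ j, j ≠ i → x j = y j) (h : ∑ j, (x j : ℝ) ≤ ∑ j, (y j : ℝ)) : x i ≤ y i := by
  by_contra! hc
  refine absurd h (not_le.2 (Finset.sum_lt_sum (fun j _ => ?_) ⟨i, Finset.mem_univ i, hc⟩))
  rcases eq_or_ne j i with rfl | hj
  · exact hc.le
  · rw [hxy j hj]

theorem IsSequentialRule₁.eq_peak (hf : IsSequentialRule₁ f) {x : Fin n → Icc (0 : ℝ) ω}
    (hx : ∑ i, (x i : ℝ) = ω) (i : Fin n) : (f x).1 i = x i :=
  le_antisymm (hf.le_peak hx.ge i) (hf.peak_le hx.le i)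

/-- Sequential rules are uncompromising: the assignment under the true peak lies between that peak
and the assignment under any other report. -/
theorem IsSequentialRule₁.between (hf : IsSequentialRule₁ f) {x y : Fin n → Icc (0 : ℝ) ω}
    {i : Fin n} (hxy : ∀ j, j ≠ i → x j = y j) :
    (x i ≤ (f x).1 i ∧ (f x).1 i ≤ (f y).1 i) ∨ ((f y).1 i ≤ (f x).1 i ∧ (f x).1 i ≤ x i) := by
  have hyx : ∀ j, j ≠ i → y j = x j := fun j hj => (hxy j hj).symm
  rcases eq_or_ne ((f x).1 i) (x i) with he | hne
  · rw [he]
    rcases le_total (x i) ((f y).1 i) with h | h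
    · exact Or.inl ⟨le_rfl, h⟩
    · exact Or.inr ⟨h, le_rfl⟩
  rcases le_total ω (∑ j, (x j : ℝ)) with hx | hx
  · have hlt := (hf.le_peak hx i).lt_of_ne hne
    refine Or.inr ⟨?_, hlt.le⟩
    rcases le_total ω (∑ j, (y j : ℝ)) with hy | hy
    · exact hf.le_of_demand hx hy hxy hlt
    -- The report switches from excess demand to excess supply. Both processes are available at the
    -- balanced profile `z`, so the comparison is chained through it.
    · obtain ⟨z, hz, hxz⟩ := exists_balanced hx hy hxy
      refine le_trans ?_ (hf.le_of_demand hx hz.ge hxz hlt)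
      have hyz : ∀ j, j ≠ i → y j = z j := fun j hj => (hyx j hj).trans (hxz j hj)
      rcases (hf.peak_le hy i).lt_or_eq with hyi | hyi
      · exact hf.le_of_supply hy hz.le hyz hyi
      · rw [← hyi, hf.eq_peak hz]
        exact le_of_sum_le_of_eq_off hyz (hy.trans hz.ge)
  · have hlt := (hf.peak_le hx i).lt_of_ne hne.symm
    refine Or.inl ⟨hlt.le, ?_⟩
    rcases le_total ω (∑ j, (y j : ℝ)) with hy | hy
    · obtain ⟨z, hz, hyz⟩ := exists_balanced hy hx hyx
      have hxz : ∀ j, j ≠ i → x j = z j := fun j hj => (hxy j hj).trans (hyz j hj)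
      refine (hf.le_of_supply hx hz.le hxz hlt).trans ?_
      rcases (hf.le_peak hy i).lt_or_eq with hyi | hyi
      · exact hf.le_of_demand hy hz.ge hyz hyi
      · rw [hyi, hf.eq_peak hz]
        exact le_of_sum_le_of_eq_off (fun j hj => (hyz j hj).symm) (hz.le.trans hy)
    · exact hf.le_of_supply hx hy hxy hlt

end OneDimensional

/-! ### Test preferences with a steep one-sided penalty. -/

section TestPreference

variable {l : ℕ} {Ω : Fin l → ℝ}

/-- Squared distance from `p` plus a one-sided linear penalty in commodity `ℓ`, on the side of the
sign of `s`. -/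
def penalizedCost (p : Fin l → ℝ) (ℓ : Fin l) (s : ℝ) (x : Fin l → ℝ) : ℝ :=
  ∑ k, (x k - p k) ^ 2 + max (s * (x ℓ - p ℓ)) 0

theorem continuous_penalizedCost (p : Fin l → ℝ) (ℓ : Fin l) (s : ℝ) :
    Continuous (penalizedCost p ℓ s) := by
  unfold penalizedCost
  fun_prop

theorem penalizedCost_lt (p : Fin l → ℝ) (ℓ : Fin l) (s : ℝ) {x y w : Fin l → ℝ} (hxy : x ≠ y)
    (hw : w ∈ openSegment ℝ x y) {C : ℝ} (hx : penalizedCost p ℓ s x ≤ C)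
    (hy : penalizedCost p ℓ s y ≤ C) : penalizedCost p ℓ s w < C := by
  obtain ⟨a, b, ha, hb, hab, rfl⟩ := hw
  obtain ⟨k, hk⟩ := Function.ne_iff.1 hxy
  have hb' : b = 1 - a := by linarith
  -- The term `a * b * (x j - y j) ^ 2` makes the convexity inequality strict in any coordinate
  -- where `x` and `y` differ.
  have hsq : ∀ j, ((a • x + b • y) j - p j) ^ 2 =
      a * (x j - p j) ^ 2 + b * (y j - p j) ^ 2 - a * b * (x j - y j) ^ 2 := fun j => by
    simp only [Pi.add_apply, Pi.smul_apply, smul_eq_mul, hb']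
    ring
  have hsum : ∑ j, ((a • x + b • y) j - p j) ^ 2 <
      a * ∑ j, (x j - p j) ^ 2 + b * ∑ j, (y j - p j) ^ 2 := by
    rw [Finset.mul_sum, Finset.mul_sum, ← Finset.sum_add_distrib]
    refine Finset.sum_lt_sum (fun j _ => ?_) ⟨k, Finset.mem_univ k, ?_⟩
    · rw [hsq]
      have : 0 ≤ a * b * (x j - y j) ^ 2 := by positivity
      linarith
    · rw [hsq]
      have hne : x k - y k ≠ 0 := sub_ne_zero.2 hk
      have : 0 < a * b * (x k - y k) ^ 2 := by positivity
      linarith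
  have hmax : max (s * ((a • x + b • y) ℓ - p ℓ)) 0 ≤
      a * max (s * (x ℓ - p ℓ)) 0 + b * max (s * (y ℓ - p ℓ)) 0 := by
    refine max_le ?_ (by positivity)
    have h1 := mul_le_mul_of_nonneg_left (le_max_left (s * (x ℓ - p ℓ)) 0) ha.le
    have h2 := mul_le_mul_of_nonneg_left (le_max_left (s * (y ℓ - p ℓ)) 0) hb.le
    refine le_trans (le_of_eq ?_) (add_le_add h1 h2)
    simp only [Pi.add_apply, Pi.smul_apply, smul_eq_mul, hb']
    ring
  unfold penalizedCost at *
  have h1 := mul_le_mul_of_nonneg_left hx ha.le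
  have h2 := mul_le_mul_of_nonneg_left hy hb.le
  have h3 : a * C + b * C = C := by rw [← add_mul, hab, one_mul]
  linarith

theorem penalizedCost_lt_of_isBetween (p : Bundle Ω) (ℓ : Fin l) (s : ℝ) {x y : Bundle Ω}
    (hxy : x ≠ y) (h : IsBetween p x y) :
    penalizedCost p.1 ℓ s x.1 < penalizedCost p.1 ℓ s y.1 := by
  obtain ⟨k, hk⟩ := Function.ne_iff.1 (fun he => hxy (Subtype.ext he))
  have hsq : ∀ j, x.1 j ≠ y.1 j → (x.1 j - p.1 j) ^ 2 < (y.1 j - p.1 j) ^ 2 := fun j hj => by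
    rcases h j with ⟨h1, h2⟩ | ⟨h1, h2⟩
    · have := h2.lt_of_ne hj
      nlinarith
    · have := h1.lt_of_ne hj.symm
      nlinarith
  have hmax : max (s * (x.1 ℓ - p.1 ℓ)) 0 ≤ max (s * (y.1 ℓ - p.1 ℓ)) 0 := by
    refine max_le ?_ (le_max_right _ _)
    rw [le_max_iff]
    -- On the penalized side the penalty grows with the distance from the peak; on the other side it
    -- vanishes at `x`.
    rcases le_total 0 s with hs | hs <;> rcases h ℓ with ⟨h1, h2⟩ | ⟨h1, h2⟩
    · left; nlinarith
    · right; nlinarith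
    · right; nlinarith
    · left; nlinarith
  refine add_lt_add_of_lt_of_le (Finset.sum_lt_sum (fun j _ => ?_)
    ⟨k, Finset.mem_univ k, hsq k hk⟩) hmax
  rcases eq_or_ne (x.1 j) (y.1 j) with he | he
  · rw [he]
  · exact (hsq j he).le

/-- The single-peaked preference that ranks bundles by their penalized cost. -/
def penalizedPreference (p : Bundle Ω) (ℓ : Fin l) (s : ℝ) : SPPreference Ω where
  rel x y := penalizedCost p.1 ℓ s x.1 ≤ penalizedCost p.1 ℓ s y.1
  complete _ _ := le_total _ _
  transitive _ _ _ := le_trans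
  continuous_upper _ :=
    isClosed_le ((continuous_penalizedCost _ _ _).comp continuous_subtype_val) continuous_const
  continuous_lower _ :=
    isClosed_le continuous_const ((continuous_penalizedCost _ _ _).comp continuous_subtype_val)
  strictly_convex _ _ _ _ hxy hx hy hw :=
    not_le.2 (penalizedCost_lt _ _ _ (fun he => hxy (Subtype.ext he)) hw hx hy)
  single_peaked := ⟨p, fun _ _ hxy h => not_le.2 (penalizedCost_lt_of_isBetween p ℓ s hxy h)⟩

theorem peak_penalizedPreference (p : Bundle Ω) (ℓ : Fin l) (s : ℝ) :
    (penalizedPreference p ℓ s).peak = p := by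
  refine (((penalizedPreference p ℓ s).rel_iff_eq_peak p).1 fun y => ?_).symm
  rcases eq_or_ne p y with rfl | hne
  · exact le_rfl
  · refine (penalizedCost_lt_of_isBetween p ℓ s hne fun k => ?_).le
    rcases le_total (p.1 k) (y.1 k) with h | h
    · exact Or.inl ⟨le_rfl, h⟩
    · exact Or.inr ⟨h, le_rfl⟩

/-- A large enough penalty outweighs all other differences. -/
theorem exists_not_penalizedPreference_rel (p : Bundle Ω) (ℓ : Fin l) (σ : ℝ) {x y : Bundle Ω}
    (h : max (σ * (y.1 ℓ - p.1 ℓ)) 0 < max (σ * (x.1 ℓ - p.1 ℓ)) 0) :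
    ∃ s, ¬ (penalizedPreference p ℓ s).rel x y := by
  set d := max (σ * (x.1 ℓ - p.1 ℓ)) 0 - max (σ * (y.1 ℓ - p.1 ℓ)) 0 with hd
  have hd0 : 0 < d := sub_pos.2 h
  set S := ∑ k, (y.1 k - p.1 k) ^ 2 with hS
  have hS0 : 0 ≤ S := Finset.sum_nonneg fun _ _ => sq_nonneg _
  -- With this scale the penalty gap `K * d` exceeds `S`, the whole quadratic cost of `y`.
  set K := (S + 1) / d with hK
  have hK0 : 0 ≤ K := by positivity
  have hKd : K * d = S + 1 := div_mul_cancel₀ _ hd0.ne'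
  refine ⟨K * σ, not_le.2 ?_⟩
  have hmul : ∀ t : ℝ, max (K * σ * t) 0 = K * max (σ * t) 0 := fun t => by
    rw [mul_max_of_nonneg _ _ hK0, mul_zero, mul_assoc]
  have hx0 : 0 ≤ ∑ k, (x.1 k - p.1 k) ^ 2 := Finset.sum_nonneg fun _ _ => sq_nonneg _
  unfold penalizedCost
  rw [hmul, hmul, ← hS]
  rw [hd, mul_sub] at hKd
  linarith

/-- If every single-peaked preference with peak `p` ranks `x` at least as high as `y`, then `x` is
between `p` and `y`. -/
theorem isBetween_of_forall_rel {p x y : Bundle Ω}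
    (h : ∀ R : SPPreference Ω, R.peak = p → R.rel x y) : IsBetween p x y := by
  intro ℓ
  -- For `σ = 1` and `σ = -1` these are the excess over the peak and the shortfall from it.
  have key : ∀ σ : ℝ, max (σ * (x.1 ℓ - p.1 ℓ)) 0 ≤ max (σ * (y.1 ℓ - p.1 ℓ)) 0 := fun σ => by
    by_contra! hc
    obtain ⟨s, hs⟩ := exists_not_penalizedPreference_rel p ℓ σ hc
    exact hs (h _ (peak_penalizedPreference p ℓ s))
  rcases lt_trichotomy (x.1 ℓ) (p.1 ℓ) with hlt | heq | hgt
  · refine Or.inr ⟨?_, hlt.le⟩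
    rcases le_max_iff.1 ((le_max_left _ _).trans (key (-1))) with h' | h' <;> linarith
  · rw [heq]
    rcases le_total (p.1 ℓ) (y.1 ℓ) with h' | h'
    · exact Or.inl ⟨le_rfl, h'⟩
    · exact Or.inr ⟨h', le_rfl⟩
  · refine Or.inl ⟨hgt.le, ?_⟩
    rcases le_max_iff.1 ((le_max_left _ _).trans (key 1)) with h' | h' <;> linarith

end TestPreference

/-! ### Strategy-proofness and undominatedness. -/

section Rules

variable {n l : ℕ} {Ω : Fin l → ℝ} {φ ψ : Rule n Ω}

theorem IsMultidimSequentialRule.strategyProof (hφ : IsMultidimSequentialRule φ) :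
    φ.StrategyProof := by
  obtain ⟨f, hf, hφf⟩ := hφ
  intro R i R'
  rcases eq_or_ne ((φ R).1 i) ((φ (Function.update R i R')).1 i) with he | hne
  · rw [← he]
    exact ((R i).complete _ _).elim id id
  · refine ((R i).complete _ _).resolve_right ((R i).peak_spec _ _ hne fun ℓ => ?_)
    rw [hφf, hφf]
    exact (hf ℓ).between (x := peakProj R ℓ) (i := i) fun j hj => by
      simp only [peakProj, Function.update_of_ne hj]

theorem IsMultidimSequentialRule.ownPeakOnly (hφ : IsMultidimSequentialRule φ) :
    φ.OwnPeakOnly := by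
  obtain ⟨f, -, hφf⟩ := hφ
  intro R i R' hR'
  have hproj : peakProj (Function.update R i R') = peakProj R := by
    funext ℓ j
    rcases eq_or_ne j i with rfl | hj
    · simp only [peakProj, Function.update_self, hR']
    · simp only [peakProj, Function.update_of_ne hj]
  refine Subtype.ext (funext fun ℓ => ?_)
  rw [hφf, hφf, hproj]

/-- Under a dominating own-peak-only rule, every agent's assignment is between her peak and her
assignment under the dominated rule. -/
theorem Rule.Dominates.isBetween (h : ψ.Dominates φ) (hψ : ψ.OwnPeakOnly) (hφ : φ.OwnPeakOnly)
    (R : Fin n → SPPreference Ω) (i : Fin n) :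
    IsBetween (R i).peak ((ψ R).1 i) ((φ R).1 i) := by
  refine isBetween_of_forall_rel fun R' hR' => ?_
  have := h (Function.update R i R') i
  rwa [Function.update_self, ← hψ R i R' hR', ← hφ R i R' hR'] at this

theorem sum_allocation_apply (z : Allocation n Ω) (ℓ : Fin l) : ∑ i, (z.1 i).1 ℓ = Ω ℓ := by
  rw [← Finset.sum_apply, z.2]

theorem IsMultidimSequentialRule.eq_of_dominates (hφ : IsMultidimSequentialRule φ)
    (hψ : ψ.OwnPeakOnly) (h : ψ.Dominates φ) : φ = ψ := by
  have hown := hφ.ownPeakOnly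
  obtain ⟨f, hf, hφf⟩ := hφ
  refine funext fun R => Subtype.ext (funext fun i => Subtype.ext (funext fun ℓ => ?_))
  have hb := fun j => h.isBetween hψ hown R j ℓ
  have hsum := (sum_allocation_apply (φ R) ℓ).trans (sum_allocation_apply (ψ R) ℓ).symm
  rcases le_total (Ω ℓ) (∑ j, (peakProj R ℓ j : ℝ)) with hx | hx
  -- Under excess demand `φ` gives at most the peak, so betweenness places `ψ` weakly above `φ` for
  -- every agent; equal totals force equality.
  · refine (Finset.sum_eq_sum_iff_of_le fun j _ => ?_).1 hsum i (Finset.mem_univ i)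
    have hle : ((φ R).1 j).1 ℓ ≤ (R j).peak.1 ℓ := by
      rw [hφf]
      exact (hf ℓ).le_peak hx j
    rcases hb j with h' | h' <;> linarith
  · refine ((Finset.sum_eq_sum_iff_of_le fun j _ => ?_).1 hsum.symm i (Finset.mem_univ i)).symm
    have hle : (R j).peak.1 ℓ ≤ ((φ R).1 j).1 ℓ := by
      rw [hφf]
      exact (hf ℓ).peak_le hx j
    rcases hb j with h' | h' <;> linarith

end Rules

theorem theorem2 {n l : ℕ} (Ω : Fin l → ℝ) (hΩ : ∀ ℓ, 0 ≤ Ω ℓ) (φ : Rule n Ω)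
    (hφ : IsMultidimSequentialRule φ) : Rule.StronglyParetoUndominatedStrategyProof φ :=
  ⟨⟨hφ.strategyProof, hφ.ownPeakOnly⟩, fun _ _ hψ h => hφ.eq_of_dominates hψ h⟩
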